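/- **Definitions.** A *cascade* is a tree $(V,\sqsubseteq)$ with a least element $\emptyset_V$ and without infinite branches; $\max V$ is the set of its maximal elements and $v^+$ the set of immediate successors of $v$. The rank of $v\in V$ is $r(v)=0$ if $v\in\max V$, and otherwise $r(v)$ is the least ordinal greater than the ranks of all elements of $v^+$; put $r(V)=r(\emptyset_V)$. A *monotone sequential cascade* is a cascade in which, for every $v\in V\setminus\max V$, the set $v^+$ is countably infinite and is enumerated without repetition as $(v_n)_{n<\omega}$ in such a way that $(r(v_n))_{n<\omega}$ is non-decreasing; these enumerations are fixed as part of $V$. All cascades below have $\max V\subset\omega$. The *contour* $\int V$ is the trace on $\max V$ of the neighbourhood filter of $\emptyset_V$ in the finest topology on $V$ such that, for every $v\in V\setminus\max V$, the cofinite filter on $v^+$ converges to $v$; it is identified with the filter on $\omega$ that it generates. For $v',v''\in V$ put $v'<_{lex}v''$ if $v'\sqsupset v''$ or if there are $v\in V\setminus \max V$ and $n<m$ with $v_n\sqsubseteq v'$ and $v_m\sqsubseteq v''$. Let $f_V:\max V\to\omega_1$ be a function with $x<_{lex}y\iff f_V(x)<f_V(y)$ for all $x,y\in\max V$. Let $\operatorname{ot}$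 denote order type, and for an ordinal $\alpha$ let $\operatorname{indec}(\alpha)$ be the largest additively indecomposable ordinal $\le\alpha$ (with $\operatorname{indec}(0)=0$). For monotone sequential cascades $T$, $V$, write $T\Rrightarrow V$ if $\max T\subset\max V$ and $\operatorname{ot}(f_T(U))\ge\operatorname{indec}(\operatorname{ot}(f_V(U)))$ for every $U\subset\max T$; this does not depend on the choice of $f_T$ and $f_V$. **Corollary 3.6.** Let $u$ be an ultrafilter on $\omega$ and let $V$, $W$ be monotone sequential cascades of finite ranks with $\int V\subset u$ and $\int W\subset u$. Then there is a monotone sequential cascade $T$ of finite rank $r(T)\ge\max\{r(V),r(W)\}$ such that $\int T\subset u$ and $T\Rrightarrow V$. -/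

import Mathlib

open scoped Ordinal

/-- A cascade: a tree (a partial order in which the elements below any given element form a
well-ordered set; here these sets are finite chains by the last two fields) with a least element
and without infinite branches, a branch being a maximal chain. -/
structure Cascade where
  Node : Type
  [instPartialOrder : PartialOrder Node]
  [instOrderBot : OrderBot Node]
  isChain_Iic : ∀ v : Node, IsChain (· ≤ ·) (Set.Iic v)
  finite_of_branch : ∀ b : Set Node, IsMaxChain (· ≤ ·) b → b.Finite

namespace Cascade

attribute [instance] Cascade.instPartialOrder Cascade.instOrderBot

/-- The maximal elements `max V`. -/
abbrev MaxNode (V : Cascade) : Type := {v : V.Node // IsMax v}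

/-- The set `v⁺` of immediate successors of `v`. -/
def succs (V : Cascade) (v : V.Node) : Set V.Node := {w | v ⋖ w}

theorem wellFoundedGT (V : Cascade) : WellFoundedGT V.Node := by
  refine wellFoundedGT_iff_monotone_chain_condition'.2 fun f => ?_
  by_contra! h
  have hc : IsChain (· ≤ ·) (Set.range f) := by
    rintro _ ⟨m, rfl⟩ _ ⟨n, rfl⟩ _
    rcases le_total m n with hmn | hmn
    · exact Or.inl (f.monotone hmn)
    · exact Or.inr (f.monotone hmn)
  obtain ⟨b, hb, hfb⟩ := hc.exists_maxChain
  have hfin : (Set.range f).Finite := (V.finite_of_branch b hb).subset hfb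
  obtain ⟨_, ⟨n, rfl⟩, hn⟩ := hfin.exists_maximal ⟨f 0, Set.mem_range_self 0⟩
  obtain ⟨m, hnm, hlt⟩ := h n
  exact hlt.not_ge (hn ⟨m, rfl⟩ hlt.le)

instance instIsWellFoundedSucc (V : Cascade) :
    IsWellFounded V.Node (fun w v => w ∈ V.succs v) :=
  ⟨Subrelation.wf (fun h => CovBy.lt h) V.wellFoundedGT.wf⟩

/-- The rank of a node: the least ordinal greater than the ranks of all its immediate successors
(so it is `0` exactly at the maximal elements). -/
noncomputable def nodeRank (V : Cascade) (v : V.Node) : Ordinal.{0} :=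
  IsWellFounded.rank (fun w v => w ∈ V.succs v) v

/-- The rank `r(V)` of a cascade is the rank of its least element. -/
noncomputable def rank (V : Cascade) : Ordinal.{0} := V.nodeRank ⊥

/-- The topology of the cascade: `O` is open if it contains almost all immediate successors of each
of its non-maximal elements. -/
@[reducible]
def topology (V : Cascade) : TopologicalSpace V.Node where
  IsOpen O := ∀ v ∈ O, ¬ IsMax v → (V.succs v \ O).Finite
  isOpen_univ := by simp
  isOpen_inter O P hO hP v hv hm := by
    rw [Set.sdiff_inter]
    exact (hO v hv.1 hm).union (hP v hv.2 hm)
  isOpen_sUnion 𝒪 h v hv hm := by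
    obtain ⟨O, hO, hvO⟩ := hv
    exact (h O hO v hvO hm).subset (Set.sdiff_subset_sdiff_right (Set.subset_sUnion_of_mem hO))

/-- `V.topology` is the finest topology (the least one in Mathlib's order of topologies) in which,
for each non-maximal `v`, the cofinite filter on `v⁺` converges to `v`. -/
theorem isLeast_topology (V : Cascade) :
    IsLeast {t : TopologicalSpace V.Node | ∀ v : V.Node, ¬ IsMax v →
      Filter.map (Subtype.val : V.succs v → V.Node) Filter.cofinite ≤ @nhds _ t v} V.topology := by
  have key : ∀ (v : V.Node) (O : Set V.Node),
      O ∈ Filter.map (Subtype.val : V.succs v → V.Node) Filter.cofinite ↔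
        (V.succs v \ O).Finite := by
    intro v O
    rw [Filter.mem_map, Filter.mem_cofinite,
      ← Set.finite_image_iff (f := Subtype.val) Subtype.val_injective.injOn]
    have himg : Subtype.val '' (Subtype.val ⁻¹' O : Set (V.succs v))ᶜ = V.succs v \ O := by
      ext w; simp
    rw [himg]
  constructor
  · intro v hv O hO
    obtain ⟨P, hPO, hP, hvP⟩ := (@mem_nhds_iff _ V.topology _ _).1 hO
    exact Filter.mem_of_superset ((key v P).2 (hP v hvP hv)) hPO
  · intro t ht O hO v hvO hv
    exact (key v O).1 (ht v hv (@IsOpen.mem_nhds _ t _ _ hO hvO))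

end Cascade

/-- A monotone sequential cascade on `ω`. -/
structure MonotoneSequentialCascade extends Cascade where
  /-- The enumeration `(v_n)` of `v⁺` in order type `ω` (irrelevant if `v` is maximal). -/
  next : Node → ℕ → Node
  /-- For non-maximal `v`, `n ↦ v_n` is a bijection onto `v⁺`; in particular `v⁺` is countably
  infinite, which is what makes the cascade sequential. -/
  bijOn_next : ∀ v : Node, ¬ IsMax v → Set.BijOn (next v) Set.univ (toCascade.succs v)
  /-- The ranks along each of these enumerations are non-decreasing. -/
  monotone_rank : ∀ v : Node, ¬ IsMax v → Monotone fun n => toCascade.nodeRank (next v n)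
  /-- The maximal elements are natural numbers, via this injection. -/
  leaf : toCascade.MaxNode ↪ ℕ

/-- The set `ω₁` of countable ordinals. -/
abbrev OmegaOne : Type 1 := Set.Iio (ω₁ : Ordinal.{0})

namespace MonotoneSequentialCascade

/-- `max V`, as a set of natural numbers. -/
def maxSet (V : MonotoneSequentialCascade) : Set ℕ := Set.range V.leaf

/-- The contour `∫ V`: the trace on `max V` of the neighbourhood filter of the least element, as a
filter on `ω`. -/
def contour (V : MonotoneSequentialCascade) : Filter ℕ :=
  Filter.map V.leaf (Filter.comap (Subtype.val : V.MaxNode → V.Node) (@nhds _ V.topology ⊥))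

/-- The lexicographic order on the nodes. -/
def LexLT (V : MonotoneSequentialCascade) (x y : V.Node) : Prop :=
  y < x ∨ ∃ v : V.Node, ¬ IsMax v ∧ ∃ n m : ℕ, V.next v n ≤ x ∧ V.next v m ≤ y ∧ n < m

/-- `f` is a lexicographic order respecting function `max V → ω₁`. -/
def IsLexRespecting (V : MonotoneSequentialCascade) (f : V.MaxNode → OmegaOne) : Prop :=
  ∀ x y : V.MaxNode, V.LexLT x y ↔ f x < f y

/-- The order type of a set of countable ordinals. -/
noncomputable def ot (S : Set OmegaOne) : Ordinal.{1} :=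
  Ordinal.type fun a b : S => a < b

/-- The biggest (additively) indecomposable ordinal less than or equal to `α`. Here `0` counts as
indecomposable, so that `indec 0 = 0`. -/
noncomputable def indec (α : Ordinal.{1}) : Ordinal.{1} :=
  sSup {β | Ordinal.IsPrincipal (· + ·) β ∧ β ≤ α}

/-- `W` increases the order of `V`. The order types of the sets `f_W(U)` and `f_V(U)` do not
depend on which order respecting functions `f_W`, `f_V` are used. -/
def IncreasesOrder (W V : MonotoneSequentialCascade) : Prop :=
  W.maxSet ⊆ V.maxSet ∧
    ∃ (fW : W.MaxNode → OmegaOne) (fV : V.MaxNode → OmegaOne),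
      W.IsLexRespecting fW ∧ V.IsLexRespecting fV ∧
        ∀ U : Set ℕ, U ⊆ W.maxSet →
          indec (ot (fV '' (V.leaf ⁻¹' U))) ≤ ot (fW '' (W.leaf ⁻¹' U))

end MonotoneSequentialCascade

/-!
Write `n` and `m` for the ranks of `V` and `W`. A leaf of `V` is coded by the indices of the
immediate successors chosen on the way from the least element to it, that is by the values of
functions `a₀, …, aₙ₋₁ : ℕ → ℕ`, its *digits* (`digits`). Only the growth of the digits with
respect to the ultrafilter `u` matters. Say that `p` lies in a lower sky than `h` (`SkyLT`) if
`φ ∘ p < h` holds `u`-almost everywhere for every `φ : ℕ → ℕ`. As `u` is an ultrafilter, this is a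
strict weak order. Moreover, a function in a higher sky than finitely many given ones exceeds every
function of all of them (`SkyLT.eventually_listKey_lt`), because of any two values one is the
smaller, so that a pair of values is one of finitely many determined by the greater value.

If `∫ V ⊂ u`, then the digits of `V` lie in strictly increasing skies (`pairwise_skyLT_digits`):
the sets on which each digit exceeds a bound that depends on the preceding digits belong to `∫ V`.
The same holds for `W`. Two increasing sequences in a strict weak order can be merged, keeping all
of the first one and from the second one only what lies in new skies; this yields an increasing
sequence `l` that contains all digits of `V` and has length at least `max n m` (`exists_merge`).
Conversely, the values of an increasing sequence of functions form, after pruning, a tree in which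
every node below the top level has infinitely many immediate successors, and `u` contains the
contour of the resulting cascade `T` (`exists_cascade_of_pairwise_skyLT`).

That `T ⇛ V` comes from a combinatorial description of order types. For the lexicographic order of
the values of a list of functions, the type of `U` is at least `ω ^ j` if and only if `U` is
`Large l j`, a notion defined by recursion on `l`: some fibre of the first function is large for
`j`, or `j = i + 1` and infinitely many fibres are large for `i`. Largeness is partition regular
(`Large.union`), and therefore it survives when a function that is dominated by the others is put
in front of the list (`Large.cons`). So a set that is large for the digits of `V` is large for `l`.
-/

/-! ### Skies of functions with respect to an ultrafilter -/

/-- `p` lies in a strictly lower sky than `h` with respect to `u`: no function of `p` bounds `h` on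
a set of `u`. -/
def SkyLT (u : Ultrafilter ℕ) (p h : ℕ → ℕ) : Prop :=
  ∀ φ : ℕ → ℕ, ∀ᶠ x in (u : Filter ℕ), φ (p x) < h x

namespace SkyLT

variable {u : Ultrafilter ℕ} {p q h : ℕ → ℕ}

theorem eventually_lt (hp : SkyLT u p h) : ∀ᶠ x in (u : Filter ℕ), p x < h x := hp id

theorem comp (hp : SkyLT u p h) (φ : ℕ → ℕ) : SkyLT u (fun x => φ (p x)) h :=
  fun ψ => hp (fun n => ψ (φ n))

theorem trans (hpq : SkyLT u p q) (hqh : SkyLT u q h) : SkyLT u p h := by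
  intro φ
  filter_upwards [hpq φ, hqh id] with x h₁ h₂
  exact h₁.trans h₂

theorem not_iff : ¬ SkyLT u p h ↔ ∃ φ : ℕ → ℕ, ∀ᶠ x in (u : Filter ℕ), h x ≤ φ (p x) := by
  simp only [SkyLT, not_forall, ← Ultrafilter.eventually_not, not_lt]

/-- If `p` is bounded by a function of `q`, then whatever lies above the sky of `q` lies above that
of `p`. Together with `trans` this makes `SkyLT u` a strict weak order. -/
theorem trans_of_not (hqp : ¬ SkyLT u q p) (hqh : SkyLT u q h) : SkyLT u p h := by
  obtain ⟨φ, hφ⟩ := not_iff.1 hqp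
  intro ψ
  filter_upwards [hφ, hqh (fun n => (Finset.range (φ n + 1)).sup ψ)] with x h₁ h₂
  exact (Finset.le_sup (f := ψ) (Finset.mem_range.2 (Nat.lt_succ_of_le h₁))).trans_lt h₂

/-- The functions below the sky of `h` are closed under pairing, since `u` decides which of the two
entries is the greater one and the other entry then has only finitely many possible values. -/
theorem pair (hp : SkyLT u p h) (hq : SkyLT u q h) :
    SkyLT u (fun x => Nat.pair (p x) (q x)) h := by
  intro φ
  have hpq : ∀ᶠ x in (u : Filter ℕ), p x ≤ q x ∨ q x ≤ p x := .of_forall fun x => le_total _ _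
  rcases Ultrafilter.eventually_or.1 hpq with hle | hle
  · filter_upwards [hle,
      hq (fun n => (Finset.range (n + 1)).sup fun i => φ (Nat.pair i n))] with x h₁ h₂
    exact (Finset.le_sup (f := fun i => φ (Nat.pair i (q x)))
      (Finset.mem_range.2 (Nat.lt_succ_of_le h₁))).trans_lt h₂
  · filter_upwards [hle,
      hp (fun n => (Finset.range (n + 1)).sup fun i => φ (Nat.pair n i))] with x h₁ h₂
    exact (Finset.le_sup (f := fun i => φ (Nat.pair (p x) i))
      (Finset.mem_range.2 (Nat.lt_succ_of_le h₁))).trans_lt h₂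

end SkyLT

/-- The list of the values at `x` of a list of functions. -/
def listKey (l : List (ℕ → ℕ)) (x : ℕ) : List ℕ := l.map fun g => g x

@[simp] theorem listKey_nil (x : ℕ) : listKey [] x = [] := rfl

@[simp] theorem listKey_cons (g : ℕ → ℕ) (l : List (ℕ → ℕ)) (x : ℕ) :
    listKey (g :: l) x = g x :: listKey l x := rfl

@[simp] theorem length_listKey (l : List (ℕ → ℕ)) (x : ℕ) : (listKey l x).length = l.length := by
  simp [listKey]

theorem take_listKey (l : List (ℕ → ℕ)) (d : ℕ) (x : ℕ) :
    (listKey l x).take d = listKey (l.take d) x := by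
  simp [listKey, List.map_take]

/-- A function `h` in a higher sky than every function in `l` exceeds every function of all of them
together. -/
theorem SkyLT.eventually_listKey_lt {u : Ultrafilter ℕ} {h : ℕ → ℕ} (h₀ : SkyLT u (fun _ => 0) h)
    {l : List (ℕ → ℕ)} (hl : ∀ g ∈ l, SkyLT u g h) (M : List ℕ → ℕ) :
    ∀ᶠ x in (u : Filter ℕ), M (listKey l x) < h x := by
  have key : SkyLT u (fun x => Encodable.encode (listKey l x)) h := by
    induction l with
    | nil => simpa using h₀
    | cons g l ih =>
      simp only [listKey_cons, Encodable.encode_list_cons]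
      exact ((hl g (by simp)).pair (ih fun g hg => hl g (by simp [hg]))).comp Nat.succ
  filter_upwards [key fun n => ((Encodable.decode n).map M).getD 0] with x hx
  simpa using hx

theorem take_succ_listKey {l : List (ℕ → ℕ)} {d : ℕ} (hd : d < l.length) (x : ℕ) :
    (listKey l x).take (d + 1) = (listKey l x).take d ++ [l[d] x] := by
  rw [List.take_add_one, List.getElem?_eq_getElem (by simpa using hd)]
  simp [listKey]

theorem eventually_take_listKey_lt {u : Ultrafilter ℕ} {l : List (ℕ → ℕ)}
    (hl : l.Pairwise (SkyLT u)) (hl₀ : ∀ g ∈ l, SkyLT u (fun _ => 0) g) {d : ℕ}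
    (hd : d < l.length) (M : List ℕ → ℕ) :
    ∀ᶠ x in (u : Filter ℕ), M ((listKey l x).take d) < l[d] x := by
  simp only [take_listKey]
  refine SkyLT.eventually_listKey_lt (hl₀ _ (List.getElem_mem _)) (fun g hg => ?_) M
  obtain ⟨i, hi, rfl⟩ := List.mem_take_iff_getElem.1 hg
  exact List.pairwise_iff_getElem.1 hl i d _ _ (by omega)

theorem eventually_pairwise_le {u : Ultrafilter ℕ} {l : List (ℕ → ℕ)}
    (hl : l.Pairwise (SkyLT u)) :
    ∀ᶠ x in (u : Filter ℕ), l.Pairwise fun g h => g x ≤ h x := by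
  induction hl with
  | nil => simp
  | @cons g l hg _ ih =>
    have hall : ∀ᶠ x in (u : Filter ℕ), ∀ h ∈ {h | h ∈ l}, g x ≤ h x :=
      (Filter.eventually_all_finite l.finite_toSet).2 fun h hh =>
        (hg h hh).eventually_lt.mono fun _ => le_of_lt
    filter_upwards [ih, hall] with x hx hgx
    exact List.pairwise_cons.2 ⟨hgx, hx⟩

/-- Two chains of skies can be merged so that all functions of the first chain are kept; a function
of the second chain is dropped when its sky occurs in the first one. -/
theorem exists_merge {u : Ultrafilter ℕ} (l₁ l₂ : List (ℕ → ℕ))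
    (h₁ : l₁.Pairwise (SkyLT u)) (h₂ : l₂.Pairwise (SkyLT u)) :
    ∃ l : List (ℕ → ℕ), l₁.Sublist l ∧ l₂.length ≤ l.length ∧ l.Pairwise (SkyLT u) ∧
      ∀ g ∈ l, g ∈ l₁ ∨ g ∈ l₂ := by
  induction l₁ generalizing l₂ with
  | nil => exact ⟨l₂, by simp, le_rfl, h₂, by simp⟩
  | cons a l₁ ih₁ =>
    induction l₂ with
    | nil => exact ⟨a :: l₁, List.Sublist.refl _, by simp, h₁, by simp⟩
    | cons b l₂ ih₂ =>
      have ha := List.pairwise_cons.1 h₁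
      have hb := List.pairwise_cons.1 h₂
      by_cases hba : SkyLT u b a
      · obtain ⟨l, hs, hlen, hp, hm⟩ := ih₂ hb.2
        refine ⟨b :: l, hs.cons b, by simpa using hlen, List.pairwise_cons.2 ⟨fun g hg => ?_, hp⟩,
          by grind⟩
        rcases hm g hg with hg | hg
        · rcases List.mem_cons.1 hg with rfl | hg
          · exact hba
          · exact hba.trans (ha.1 g hg)
        · exact hb.1 g hg
      · by_cases hab : SkyLT u a b
        · obtain ⟨l, hs, hlen, hp, hm⟩ := ih₁ (b :: l₂) ha.2 h₂
          refine ⟨a :: l, hs.cons_cons a, by simp at hlen ⊢; omega,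
            List.pairwise_cons.2 ⟨fun g hg => ?_, hp⟩, by grind⟩
          rcases hm g hg with hg | hg
          · exact ha.1 g hg
          · rcases List.mem_cons.1 hg with rfl | hg
            · exact hab
            · exact hab.trans (hb.1 g hg)
        · obtain ⟨l, hs, hlen, hp, hm⟩ := ih₁ l₂ ha.2 hb.2
          refine ⟨a :: l, hs.cons_cons a, by simpa using hlen,
            List.pairwise_cons.2 ⟨fun g hg => ?_, hp⟩, by grind⟩
          rcases hm g hg with hg | hg
          · exact ha.1 g hg
          · exact SkyLT.trans_of_not hba (hb.1 g hg)

/-! ### Large sets -/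

/-- If the functions in `l` together separate the points of `U`, then `Large l j U` says that the
order type of `U`, ordered lexicographically by their values, is at least `ω ^ j` (see `RespectsKey.ot_lt_of_not_large` and
`RespectsKey.le_ot_of_large`). The definition is a recursion on `l` that mentions no ordinals. -/
def Large : List (ℕ → ℕ) → ℕ → Set ℕ → Prop
  | [], j, U => j = 0 ∧ U.Nonempty
  | g :: l, j, U => (∃ c, Large l j (U ∩ g ⁻¹' {c})) ∨
      ∃ i, j = i + 1 ∧ {c | Large l i (U ∩ g ⁻¹' {c})}.Infinite

namespace Large

theorem mono {l : List (ℕ → ℕ)} {j : ℕ} {U U' : Set ℕ} (hU : U ⊆ U') (h : Large l j U) :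
    Large l j U' := by
  induction l generalizing j U U' with
  | nil => exact ⟨h.1, h.2.mono hU⟩
  | cons g l ih =>
    have hc : ∀ c, U ∩ g ⁻¹' {c} ⊆ U' ∩ g ⁻¹' {c} := fun c => Set.inter_subset_inter_left _ hU
    rcases h with ⟨c, h⟩ | ⟨i, rfl, h⟩
    · exact Or.inl ⟨c, ih (hc c) h⟩
    · exact Or.inr ⟨i, rfl, h.mono fun c h => ih (hc c) h⟩

theorem le_length {l : List (ℕ → ℕ)} {j : ℕ} {U : Set ℕ} (h : Large l j U) : j ≤ l.length := by
  induction l generalizing j U with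
  | nil => exact h.1.le
  | cons g l ih =>
    rcases h with ⟨c, h⟩ | ⟨i, rfl, h⟩
    · exact (ih h).trans (by simp)
    · obtain ⟨c, h⟩ := h.nonempty
      simpa using ih h

/-- Largeness is partition regular. -/
theorem union {l : List (ℕ → ℕ)} {j : ℕ} {U U' : Set ℕ} (h : Large l j (U ∪ U')) :
    Large l j U ∨ Large l j U' := by
  induction l generalizing j U U' with
  | nil =>
    rcases h with ⟨rfl, x, hx | hx⟩
    · exact Or.inl ⟨rfl, x, hx⟩
    · exact Or.inr ⟨rfl, x, hx⟩
  | cons g l ih =>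
    rcases h with ⟨c, h⟩ | ⟨i, rfl, h⟩
    · rw [Set.union_inter_distrib_right] at h
      exact (ih h).imp (fun h => Or.inl ⟨c, h⟩) fun h => Or.inl ⟨c, h⟩
    · have hsub : {c | Large l i ((U ∪ U') ∩ g ⁻¹' {c})} ⊆
          {c | Large l i (U ∩ g ⁻¹' {c})} ∪ {c | Large l i (U' ∩ g ⁻¹' {c})} := by
        intro c hc
        simp only [Set.mem_ofPred_eq, Set.union_inter_distrib_right] at hc
        exact ih hc
      exact (Set.infinite_union.1 (h.mono hsub)).imp (fun h => Or.inr ⟨i, rfl, h⟩)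
        fun h => Or.inr ⟨i, rfl, h⟩

theorem nonempty {l : List (ℕ → ℕ)} {j : ℕ} {U : Set ℕ} (h : Large l j U) : U.Nonempty := by
  induction l generalizing j U with
  | nil => exact h.2
  | cons g l ih =>
    rcases h with ⟨c, h⟩ | ⟨i, rfl, h⟩
    · exact (ih h).left
    · obtain ⟨c, h⟩ := h.nonempty
      exact (ih h).left

/-- If `g` takes finitely many values on a large set, then one of its fibres is large. -/
theorem exists_fiber {l : List (ℕ → ℕ)} {j : ℕ} {U : Set ℕ} {g : ℕ → ℕ} {m : ℕ}
    (hg : ∀ x ∈ U, g x ≤ m) (h : Large l j U) : ∃ c, Large l j (U ∩ g ⁻¹' {c}) := by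
  induction m generalizing U with
  | zero => exact ⟨0, h.mono fun x hx => ⟨hx, Nat.le_zero.1 (hg x hx)⟩⟩
  | succ m ih =>
    have hsub : U ⊆ (U ∩ g ⁻¹' {m + 1}) ∪ (U ∩ {x | g x ≤ m}) := by
      intro x hx
      rcases (hg x hx).eq_or_lt with h | h
      · exact Or.inl ⟨hx, h⟩
      · exact Or.inr ⟨hx, Nat.le_of_lt_succ h⟩
    rcases (h.mono hsub).union with h | h
    · exact ⟨_, h⟩
    · obtain ⟨c, hc⟩ := ih (fun x hx => hx.2) h
      exact ⟨c, hc.mono fun x hx => ⟨hx.1.1, hx.2⟩⟩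

/-- Putting in front of `l` a function that is dominated by the others preserves largeness: on each
fibre of the head `h` of `l` it takes finitely many values, so that every large fibre of `h` has a
large part on which it is constant. Either infinitely many constants occur, or one of them serves
infinitely many fibres of `h`. -/
theorem cons {l : List (ℕ → ℕ)} {j : ℕ} {U : Set ℕ} {g : ℕ → ℕ}
    (hg : ∀ h ∈ l, ∀ x ∈ U, g x ≤ h x) (hU : Large l j U) : Large (g :: l) j U := by
  cases l with
  | nil =>
    obtain ⟨rfl, x, hx⟩ := hU
    exact Or.inl ⟨g x, rfl, x, hx, rfl⟩
  | cons h l =>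
    have hfib : ∀ c i, Large l i (U ∩ h ⁻¹' {c}) →
        ∃ c', Large l i ((U ∩ g ⁻¹' {c'}) ∩ h ⁻¹' {c}) := by
      intro c i hc
      obtain ⟨c', hc'⟩ := hc.exists_fiber (g := g) (m := c) fun x hx =>
        (hg h (by simp) x hx.1).trans_eq hx.2
      exact ⟨c', hc'.mono fun x hx => ⟨⟨hx.1.1, hx.2⟩, hx.1.2⟩⟩
    rcases hU with ⟨c, hc⟩ | ⟨i, rfl, hinf⟩
    · obtain ⟨c', hc'⟩ := hfib c j hc
      exact Or.inl ⟨c', Or.inl ⟨c, hc'⟩⟩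
    · by_cases hfin : {c' | Large (h :: l) i (U ∩ g ⁻¹' {c'})}.Infinite
      · exact Or.inr ⟨i, rfl, hfin⟩
      · have hsub : {c | Large l i (U ∩ h ⁻¹' {c})} ⊆
            ⋃ c' ∈ {c' | Large (h :: l) i (U ∩ g ⁻¹' {c'})},
              {c | Large l i ((U ∩ g ⁻¹' {c'}) ∩ h ⁻¹' {c})} := by
          intro c hc
          obtain ⟨c', hc'⟩ := hfib c i hc
          exact Set.mem_biUnion (x := c') (Or.inl ⟨c, hc'⟩) hc'
        have hinf' := hinf.mono hsub
        rw [Set.not_infinite] at hfin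
        obtain ⟨c', -, hc'⟩ : ∃ c' ∈ {c' | Large (h :: l) i (U ∩ g ⁻¹' {c'})},
            {c | Large l i ((U ∩ g ⁻¹' {c'}) ∩ h ⁻¹' {c})}.Infinite := by
          by_contra! hcon
          exact hinf' (hfin.biUnion fun c' hc' => Set.not_infinite.1 (by simpa using hcon c' hc'))
        exact Or.inl ⟨c', Or.inr ⟨i, rfl, hc'⟩⟩

theorem of_sublist {l₁ l₂ : List (ℕ → ℕ)} (hl : l₁.Sublist l₂) {j : ℕ} {U : Set ℕ}
    (hp : l₂.Pairwise fun g h => ∀ x ∈ U, g x ≤ h x) (h : Large l₁ j U) : Large l₂ j U := by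
  induction hl generalizing j U with
  | slnil => exact h
  | cons g hl ih =>
    rw [List.pairwise_cons] at hp
    exact (ih hp.2 h).cons hp.1
  | @cons_cons l₁ l₂ g hl ih =>
    rw [List.pairwise_cons] at hp
    have hp' : ∀ c, l₂.Pairwise fun g' h : ℕ → ℕ => ∀ x ∈ U ∩ g ⁻¹' {c}, g' x ≤ h x :=
      fun c => hp.2.imp fun h x hx => h x hx.1
    rcases h with ⟨c, h⟩ | ⟨i, rfl, h⟩
    · exact Or.inl ⟨c, ih (hp' c) h⟩
    · exact Or.inr ⟨i, rfl, h.mono fun c h => ih (hp' c) h⟩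

end Large

/-! ### Order types of sets under lexicographic orders -/

namespace MonotoneSequentialCascade

theorem ot_mono {S S' : Set OmegaOne} (h : S ⊆ S') : ot S ≤ ot S' :=
  Ordinal.type_le_iff'.2 ⟨⟨⟨Set.inclusion h, Set.inclusion_injective h⟩, Iff.rfl⟩⟩

theorem ot_union {S S' : Set OmegaOne} (h : ∀ a ∈ S, ∀ b ∈ S', a < b) :
    ot (S ∪ S') = ot S + ot S' := by
  rw [ot, ot, ot, ← Ordinal.type_sum_lex]
  let e : S ⊕ S' → (S ∪ S' : Set OmegaOne) :=
    Sum.elim (Set.inclusion Set.subset_union_left) (Set.inclusion Set.subset_union_right)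
  refine (RelIso.ordinalType_congr (RelIso.ofSurjective (RelEmbedding.ofMonotone e ?_) ?_)).symm
  · rintro (a | a) (b | b) hab
    · exact (Sum.lex_inl_inl.1 hab : a < b)
    · exact h a a.2 b b.2
    · exact (Sum.lex_inr_inl hab).elim
    · exact (Sum.lex_inr_inr.1 hab : a < b)
  · rintro ⟨a, ha | ha⟩
    · exact ⟨Sum.inl ⟨a, ha⟩, rfl⟩
    · exact ⟨Sum.inr ⟨a, ha⟩, rfl⟩

theorem ot_le_of_forall_inter_Iio {S : Set OmegaOne} {α : Ordinal.{1}}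
    (h : ∀ a ∈ S, ot (S ∩ Set.Iio a) < α) : ot S ≤ α := by
  by_contra! hlt
  obtain ⟨⟨a, ha⟩, hα⟩ := Ordinal.typein_surj (fun a b : S => a < b) hlt
  refine (h a ha).ne ?_
  rw [← hα, ← Ordinal.type_subrel, ot]
  refine RelIso.ordinalType_congr ⟨⟨fun b => ⟨⟨b.1, b.2.1⟩, b.2.2⟩,
    fun b => ⟨b.1.1, b.1.2, b.2⟩, fun _ => rfl, fun _ => rfl⟩, Iff.rfl⟩

theorem ot_eq_zero_iff {S : Set OmegaOne} : ot S = 0 ↔ S = ∅ := by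
  rw [ot, Ordinal.type_eq_zero_iff_isEmpty, Set.isEmpty_coe_sort]

theorem ot_eq_one_of_subsingleton {S : Set OmegaOne} (hS : S.Subsingleton) (hne : S.Nonempty) :
    ot S = 1 := by
  have := hne.to_subtype
  have := hS.coe_sort
  exact Ordinal.type_eq_one_of_unique _

/-- `f` orders `U` like the lexicographic order of the lists of values of the functions in `l`. -/
def RespectsKey (f : ℕ → OmegaOne) (l : List (ℕ → ℕ)) (U : Set ℕ) : Prop :=
  ∀ x ∈ U, ∀ y ∈ U, f x < f y ↔ listKey l x < listKey l y

theorem RespectsKey.fiber {f : ℕ → OmegaOne} {g : ℕ → ℕ} {l : List (ℕ → ℕ)} {U : Set ℕ}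
    (h : RespectsKey f (g :: l) U) (c : ℕ) : RespectsKey f l (U ∩ g ⁻¹' {c}) := by
  rintro x ⟨hxU, hx⟩ y ⟨hyU, hy⟩
  have hxy : g x = g y := hx.trans hy.symm
  simp [h x hxU y hyU, hxy]

theorem RespectsKey.mono {f : ℕ → OmegaOne} {l : List (ℕ → ℕ)} {U U' : Set ℕ}
    (h : RespectsKey f l U) (hU : U' ⊆ U) : RespectsKey f l U' :=
  fun x hx y hy => h x (hU hx) y (hU hy)

theorem RespectsKey.lt_of_lt {f : ℕ → OmegaOne} {g : ℕ → ℕ} {l : List (ℕ → ℕ)} {U : Set ℕ}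
    (h : RespectsKey f (g :: l) U) {x y : ℕ} (hx : x ∈ U) (hy : y ∈ U) (hxy : g x < g y) :
    f x < f y := by
  simp [h x hx y hy, List.cons_lt_cons_iff, hxy]

theorem RespectsKey.le_of_lt {f : ℕ → OmegaOne} {g : ℕ → ℕ} {l : List (ℕ → ℕ)} {U : Set ℕ}
    (h : RespectsKey f (g :: l) U) {x y : ℕ} (hx : x ∈ U) (hy : y ∈ U) (hxy : f x < f y) :
    g x ≤ g y := by
  by_contra! hlt
  exact (h.lt_of_lt hy hx hlt).asymm hxy

/-- The fibres of the first function are consecutive blocks, so that their order types add up. -/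
theorem RespectsKey.ot_split {f : ℕ → OmegaOne} {g : ℕ → ℕ} {l : List (ℕ → ℕ)} {U : Set ℕ}
    (h : RespectsKey f (g :: l) U) (m : ℕ) :
    ot (f '' (U ∩ {x | g x ≤ m})) =
      ot (f '' (U ∩ {x | g x < m})) + ot (f '' (U ∩ g ⁻¹' {m})) := by
  rw [← ot_union, ← Set.image_union, ← Set.inter_union_distrib_left]
  · congr 3
    ext x
    simp [le_iff_lt_or_eq]
  · rintro _ ⟨x, hx, rfl⟩ _ ⟨y, hy, rfl⟩
    exact h.lt_of_lt hx.1 hy.1 (lt_of_lt_of_eq hx.2 hy.2.symm)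

theorem RespectsKey.ot_initial_lt {f : ℕ → OmegaOne} {g : ℕ → ℕ} {l : List (ℕ → ℕ)} {U : Set ℕ}
    (h : RespectsKey f (g :: l) U) {γ : Ordinal.{1}}
    (hc : ∀ c, ot (f '' (U ∩ g ⁻¹' {c})) < ω ^ γ) (m : ℕ) :
    ot (f '' (U ∩ {x | g x < m})) < ω ^ γ := by
  induction m with
  | zero => simp [ot_eq_zero_iff.2, Ordinal.opow_pos]
  | succ m ih =>
    simp_rw [Nat.lt_succ_iff, h.ot_split]
    exact Ordinal.isPrincipal_add_omega0_opow γ ih (hc m)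

/-- Past the finitely many fibres of type at least `ω ^ i`, all proper initial segments of the rest
have type less than `ω ^ i`, so that the rest has type at most `ω ^ i`. -/
theorem RespectsKey.ot_lt_of_not_large {f : ℕ → OmegaOne} {l : List (ℕ → ℕ)} {U : Set ℕ}
    (h : RespectsKey f l U) (hinj : U.InjOn (listKey l)) {j : ℕ} (hL : ¬ Large l j U) :
    ot (f '' U) < ω ^ (j : Ordinal.{1}) := by
  induction l generalizing j U with
  | nil =>
    rcases U.eq_empty_or_nonempty with rfl | hne
    · simp [ot_eq_zero_iff.2]
    · have hsub : U.Subsingleton := fun x hx y hy => hinj hx hy rfl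
      rw [ot_eq_one_of_subsingleton (hsub.image f) (hne.image f)]
      have hj : j ≠ 0 := fun hj => hL ⟨hj, hne⟩
      exact Ordinal.one_lt_opow.2 ⟨Ordinal.one_lt_omega0, by exact_mod_cast hj⟩
  | cons g l ih =>
    simp only [Large, not_or, not_exists, not_and] at hL
    obtain ⟨hL₁, hL₂⟩ := hL
    have hinj' : ∀ c, (U ∩ g ⁻¹' {c}).InjOn (listKey l) := by
      rintro c x ⟨hxU, hx⟩ y ⟨hyU, hy⟩ hxy
      have hg : g x = g y := hx.trans hy.symm
      exact hinj hxU hyU (by simp [hg, hxy])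
    have hc : ∀ c, ot (f '' (U ∩ g ⁻¹' {c})) < ω ^ (j : Ordinal.{1}) := fun c =>
      ih (h.fiber c) (hinj' c) (hL₁ c)
    rcases j with _ | i
    -- For `j = 0` the bound `ω ^ 0 = 1` forces all fibres to be empty.
    · have : U = ∅ := by
        refine Set.eq_empty_of_forall_notMem fun x hx => ?_
        have := hc (g x)
        rw [Nat.cast_zero, Ordinal.opow_zero, Order.lt_one_iff, ot_eq_zero_iff,
          Set.image_eq_empty] at this
        exact Set.eq_empty_iff_forall_notMem.1 this x ⟨hx, rfl⟩
      simp [this, ot_eq_zero_iff.2]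
    · have hfin := Set.not_infinite.1 (hL₂ i rfl)
      obtain ⟨m, hm⟩ := hfin.bddAbove
      set U' := U ∩ {x | m < g x} with hU'
      have h' : RespectsKey f (g :: l) U' := h.mono Set.inter_subset_left
      have hc' : ∀ c, ot (f '' (U' ∩ g ⁻¹' {c})) < ω ^ (i : Ordinal.{1}) := by
        intro c
        refine ih (h'.fiber c) ((hinj' c).mono <|
          Set.inter_subset_inter_left _ Set.inter_subset_left) fun hlarge => ?_
        obtain ⟨x, ⟨-, hx⟩, rfl⟩ := hlarge.nonempty
        exact hx.not_ge (hm (hlarge.mono (Set.inter_subset_inter_left _ Set.inter_subset_left)))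
      have hle : ot (f '' U') ≤ ω ^ (i : Ordinal.{1}) := by
        refine ot_le_of_forall_inter_Iio ?_
        rintro _ ⟨x, hx, rfl⟩
        refine (ot_mono ?_).trans_lt (h'.ot_initial_lt hc' (g x + 1))
        rintro _ ⟨⟨y, hy, rfl⟩, hyx⟩
        exact ⟨y, ⟨hy, Nat.lt_succ_of_le (h'.le_of_lt hy hx hyx)⟩, rfl⟩
      have hlt : ot (f '' U') < ω ^ ((i + 1 : ℕ) : Ordinal.{1}) :=
        hle.trans_lt ((Ordinal.opow_lt_opow_iff_right Ordinal.one_lt_omega0).2 (by simp))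
      have hU : f '' U = f '' (U ∩ {x | g x < m + 1}) ∪ f '' U' := by
        rw [← Set.image_union, hU', ← Set.inter_union_distrib_left]
        congr 1
        ext x
        simp [le_or_gt]
      rw [hU, ot_union]
      · exact Ordinal.isPrincipal_add_omega0_opow _ (h.ot_initial_lt hc _) hlt
      · rintro _ ⟨x, hx, rfl⟩ _ ⟨y, hy, rfl⟩
        exact h.lt_of_lt hx.1 hy.1 (lt_of_lt_of_le hx.2 hy.2)

theorem RespectsKey.le_ot_of_large {f : ℕ → OmegaOne} {l : List (ℕ → ℕ)} {U : Set ℕ}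
    (h : RespectsKey f l U) {j : ℕ} (hL : Large l j U) :
    ω ^ (j : Ordinal.{1}) ≤ ot (f '' U) := by
  induction l generalizing j U with
  | nil =>
    obtain ⟨rfl, hne⟩ := hL
    simp only [Nat.cast_zero, Ordinal.opow_zero, Order.one_le_iff_pos]
    exact pos_iff_ne_zero.2 fun h0 => (hne.image f).ne_empty (ot_eq_zero_iff.1 h0)
  | cons g l ih =>
    rcases hL with ⟨c, hc⟩ | ⟨i, rfl, hinf⟩
    · exact (ih (h.fiber c) hc).trans (ot_mono (Set.image_mono Set.inter_subset_left))
    · have hk : ∀ k : ℕ, ∃ m, ω ^ (i : Ordinal.{1}) * (k : Ordinal.{1}) ≤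
          ot (f '' (U ∩ {x | g x < m})) := by
        intro k
        induction k with
        | zero => exact ⟨0, by simp⟩
        | succ k ihk =>
          obtain ⟨m, hm⟩ := ihk
          obtain ⟨c, hc, hmc⟩ := hinf.exists_gt m
          refine ⟨c + 1, ?_⟩
          simp_rw [Nat.lt_succ_iff]
          rw [h.ot_split, Nat.cast_succ, mul_add_one]
          refine add_le_add (hm.trans (ot_mono (Set.image_mono ?_))) (ih (h.fiber c) hc)
          exact fun x hx => ⟨hx.1, lt_trans hx.2 hmc⟩
      rw [Nat.cast_succ, Ordinal.opow_add, Ordinal.opow_one,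
        Ordinal.mul_le_iff_of_isSuccLimit Ordinal.isSuccLimit_omega0]
      intro b hb
      obtain ⟨k, rfl⟩ := Ordinal.lt_omega0.1 hb
      obtain ⟨m, hm⟩ := hk k
      exact hm.trans (ot_mono (Set.image_mono Set.inter_subset_left))

/-- The comparison of order types behind `T ⇛ V`. -/
theorem indec_ot_le {fV fT : ℕ → OmegaOne} {lV lT : List (ℕ → ℕ)} {U : Set ℕ}
    (hV : RespectsKey fV lV U) (hinj : U.InjOn (listKey lV)) (hT : RespectsKey fT lT U)
    (hsub : lV.Sublist lT) (hlT : lT.Pairwise fun g h => ∀ x ∈ U, g x ≤ h x) :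
    indec (ot (fV '' U)) ≤ ot (fT '' U) := by
  refine csSup_le ⟨0, Ordinal.isPrincipal_zero, zero_le⟩ ?_
  rintro β ⟨hβ, hle⟩
  have key : ∀ j : ℕ, ω ^ (j : Ordinal.{1}) ≤ ot (fV '' U) → Large lV j U := fun j hj => by
    by_contra hL
    exact (hV.ot_lt_of_not_large hinj hL).not_ge hj
  rcases Ordinal.isPrincipal_add_iff_zero_or_omega0_opow.1 hβ with rfl | ⟨γ, rfl⟩
  · exact zero_le
  · rcases lt_or_ge γ ω with hγ | hγ
    · obtain ⟨j, rfl⟩ := Ordinal.lt_omega0.1 hγ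
      exact hT.le_ot_of_large ((key j hle).of_sublist hsub hlT)
    -- An infinite exponent is impossible, as a set is at most `lV.length`-large.
    · have := (key (lV.length + 1) (le_trans (Ordinal.opow_le_opow_right Ordinal.omega0_pos
        ((Ordinal.natCast_lt_omega0 _).le.trans hγ)) hle)).le_length
      omega

/-- The ordinal below `ω ^ s.length` whose coefficients in base `ω` are the entries of `s`, the
first entry being the leading coefficient. -/
noncomputable def keyOrdinal : List ℕ → Ordinal.{0}
  | [] => 0
  | a :: s => ω ^ (s.length : Ordinal.{0}) * a + keyOrdinal s

theorem keyOrdinal_lt (s : List ℕ) : keyOrdinal s < ω ^ (s.length : Ordinal.{0}) := by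
  induction s with
  | nil => simp [keyOrdinal]
  | cons a s ih =>
    rw [keyOrdinal, List.length_cons, Nat.cast_succ, Ordinal.opow_add, Ordinal.opow_one]
    calc _ < ω ^ (s.length : Ordinal.{0}) * a + ω ^ (s.length : Ordinal.{0}) := by gcongr
      _ = ω ^ (s.length : Ordinal.{0}) * ((a + 1 : ℕ) : Ordinal.{0}) := by
        rw [Nat.cast_succ, mul_add_one]
      _ ≤ _ := by gcongr; exact (Ordinal.natCast_lt_omega0 _).le

theorem keyOrdinal_lt_keyOrdinal {s t : List ℕ} (hlen : s.length = t.length) (h : s < t) :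
    keyOrdinal s < keyOrdinal t := by
  induction s generalizing t with
  | nil => cases t <;> simp_all
  | cons a s ih =>
    cases t with
    | nil => simp at hlen
    | cons b t =>
      simp only [List.length_cons, add_left_inj] at hlen
      rw [keyOrdinal, keyOrdinal, ← hlen]
      rcases List.cons_lt_cons_iff.1 h with hab | ⟨rfl, hst⟩
      · calc _ < ω ^ (s.length : Ordinal.{0}) * a + ω ^ (s.length : Ordinal.{0}) := by
              gcongr; exact keyOrdinal_lt s
          _ = ω ^ (s.length : Ordinal.{0}) * ((a + 1 : ℕ) : Ordinal.{0}) := by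
            rw [Nat.cast_succ, mul_add_one]
          _ ≤ ω ^ (s.length : Ordinal.{0}) * b := by
            gcongr; exact_mod_cast hab
          _ ≤ _ := le_self_add
      · gcongr; exact ih hlen hst

theorem keyOrdinal_lt_iff {s t : List ℕ} (hlen : s.length = t.length) :
    keyOrdinal s < keyOrdinal t ↔ s < t := by
  refine ⟨fun h => ?_, keyOrdinal_lt_keyOrdinal hlen⟩
  by_contra hst
  rcases (not_lt.1 hst).eq_or_lt with rfl | hlt
  · exact h.false
  · exact h.asymm (keyOrdinal_lt_keyOrdinal hlen.symm hlt)

theorem omega0_opow_natCast_lt_omega_one (n : ℕ) : ω ^ (n : Ordinal.{0}) < (ω₁ : Ordinal.{0}) := by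
  rw [← Cardinal.ord_aleph, Cardinal.lt_ord]
  refine (Ordinal.card_opow_le _ _).trans_lt ?_
  simp

/-- The map into `ω₁` that orders `ℕ` by the values of the functions in `l`. -/
noncomputable def keyMap (l : List (ℕ → ℕ)) (x : ℕ) : OmegaOne :=
  ⟨keyOrdinal (listKey l x), (keyOrdinal_lt _).trans (omega0_opow_natCast_lt_omega_one _)⟩

theorem keyMap_lt_iff {l : List (ℕ → ℕ)} {x y : ℕ} :
    keyMap l x < keyMap l y ↔ listKey l x < listKey l y := by
  rw [← keyOrdinal_lt_iff (by simp)]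
  exact Iff.rfl

end MonotoneSequentialCascade

/-! ### Digits of the leaves of a cascade -/

theorem List.lt_of_isPrefix_of_lt {p s t : List ℕ} {c c' : ℕ} (hs : p ++ [c] <+: s)
    (ht : p ++ [c'] <+: t) (hc : c < c') : s < t := by
  obtain ⟨s, rfl⟩ := hs
  obtain ⟨t, rfl⟩ := ht
  simp only [List.append_assoc, List.singleton_append]
  exact List.append_left_lt (List.cons_lt_cons_iff.2 (Or.inl hc))

theorem List.exists_diverge {s t : List ℕ} (hst : ¬ s <+: t) (hts : ¬ t <+: s) :
    ∃ p c c', c ≠ c' ∧ p ++ [c] <+: s ∧ p ++ [c'] <+: t := by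
  induction s generalizing t with
  | nil => simp at hst
  | cons a s ih =>
    cases t with
    | nil => simp at hts
    | cons b t =>
      by_cases hab : a = b
      · subst hab
        obtain ⟨p, c, c', hc, hs, ht⟩ := @ih t (by simpa using hst) (by simpa using hts)
        exact ⟨a :: p, c, c', hc, by simpa using hs, by simpa using ht⟩
      · exact ⟨[], a, b, hab, by simp, by simp⟩

theorem Cascade.finite_Iic (V : Cascade) (x : V.Node) : (Set.Iic x).Finite := by
  obtain ⟨b, hb, hxb⟩ := (V.isChain_Iic x).exists_maxChain
  exact (V.finite_of_branch b hb).subset hxb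

namespace MonotoneSequentialCascade

variable {V : MonotoneSequentialCascade}

theorem covBy_next {v : V.Node} (hv : ¬ IsMax v) (c : ℕ) : v ⋖ V.next v c :=
  (V.bijOn_next v hv).mapsTo (Set.mem_univ c)

theorem exists_next_le {v x : V.Node} (h : v < x) : ∃ c, V.next v c ≤ x := by
  have hfin : (Set.Ioc v x).Finite := (V.finite_Iic x).subset fun w hw => hw.2
  obtain ⟨w, hw⟩ := hfin.exists_minimal ⟨x, h, le_rfl⟩
  have hcov : v ⋖ w := by
    refine ⟨hw.prop.1, fun z hvz hzw => ?_⟩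
    exact hw.not_lt ⟨hvz, hzw.le.trans hw.prop.2⟩ hzw
  obtain ⟨c, -, rfl⟩ := (V.bijOn_next v h.not_isMax).surjOn hcov
  exact ⟨c, hw.prop.2⟩

theorem eq_of_covBy {v v' w : V.Node} (h : v ⋖ w) (h' : v' ⋖ w) : v = v' := by
  rcases (V.isChain_Iic w).total h.le h'.le with hle | hle
  · exact (hle.eq_or_lt).resolve_right fun hlt => h.2 hlt h'.1
  · exact ((hle.eq_or_lt).resolve_right fun hlt => h'.2 hlt h.1).symm

/-- `V.IsAddress s v` says that `v` is reached from the least element by choosing, in turn, the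
immediate successors whose indices are the entries of `s`. Each node has exactly one address. -/
inductive IsAddress (V : MonotoneSequentialCascade) : List ℕ → V.Node → Prop
  | nil : IsAddress V [] ⊥
  | snoc {s : List ℕ} {v : V.Node} (h : IsAddress V s v) (hv : ¬ IsMax v) (c : ℕ) :
      IsAddress V (s ++ [c]) (V.next v c)

namespace IsAddress

theorem eq_nil_or {s : List ℕ} {w : V.Node} (h : V.IsAddress s w) :
    (s = [] ∧ w = ⊥) ∨
      ∃ s' v c, s = s' ++ [c] ∧ w = V.next v c ∧ ¬ IsMax v ∧ V.IsAddress s' v := by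
  cases h with
  | nil => exact Or.inl ⟨rfl, rfl⟩
  | snoc h hv c => exact Or.inr ⟨_, _, c, rfl, rfl, hv, h⟩

theorem of_snoc {s : List ℕ} {c : ℕ} {w : V.Node} (h : V.IsAddress (s ++ [c]) w) :
    ∃ v, V.IsAddress s v ∧ ¬ IsMax v ∧ w = V.next v c := by
  rcases h.eq_nil_or with ⟨h, -⟩ | ⟨s', v, c', hs, hw, hv, h⟩
  · simp at h
  · obtain ⟨rfl, hc⟩ := List.append_inj' hs rfl
    obtain rfl : c = c' := by simpa using hc
    exact ⟨v, h, hv, hw⟩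

theorem unique_node {s : List ℕ} {v w : V.Node} (hv : V.IsAddress s v) (hw : V.IsAddress s w) :
    v = w := by
  induction hv generalizing w with
  | nil =>
    rcases hw.eq_nil_or with ⟨-, h⟩ | ⟨s', v, c, h, -⟩
    · exact h.symm
    · simp at h
  | snoc h hv c ih =>
    obtain ⟨v', h', -, rfl⟩ := hw.of_snoc
    rw [ih h']

theorem unique {s t : List ℕ} {w : V.Node} (hs : V.IsAddress s w) (ht : V.IsAddress t w) :
    s = t := by
  induction hs generalizing t with
  | nil =>
    rcases ht.eq_nil_or with ⟨h, -⟩ | ⟨s', v, c, -, hw, hv, -⟩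
    · exact h.symm
    · exact absurd ((covBy_next hv c).lt.trans_eq hw.symm) not_lt_bot
  | snoc h hv c ih =>
    rcases ht.eq_nil_or with ⟨-, hw⟩ | ⟨s', v', c', rfl, hw, hv', h'⟩
    · exact absurd ((covBy_next hv c).lt.trans_eq hw) not_lt_bot
    · obtain rfl := eq_of_covBy (hw ▸ covBy_next hv c) (covBy_next hv' c')
      rw [ih h', (V.bijOn_next _ hv).injOn (Set.mem_univ _) (Set.mem_univ _) hw]

theorem exists_extension {x : V.Node} {s : List ℕ} {v : V.Node} (h : V.IsAddress s v)
    (hvx : v ≤ x) : ∃ t, V.IsAddress (s ++ t) x := by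
  induction v using V.wellFoundedGT.induction generalizing s with
  | ind v ih =>
    rcases hvx.eq_or_lt with rfl | hlt
    · exact ⟨[], by simpa using h⟩
    · obtain ⟨c, hc⟩ := exists_next_le hlt
      obtain ⟨t, ht⟩ := ih _ (covBy_next hlt.not_isMax c).lt (h.snoc hlt.not_isMax c) hc
      exact ⟨c :: t, by simpa using ht⟩

theorem isPrefix {s t : List ℕ} {v w : V.Node} (hs : V.IsAddress s v) (ht : V.IsAddress t w)
    (h : v ≤ w) : s <+: t := by
  obtain ⟨t', ht'⟩ := hs.exists_extension h
  exact ⟨t', ht'.unique ht⟩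

theorem exists_le {s t : List ℕ} {x : V.Node} (h : V.IsAddress (s ++ t) x) :
    ∃ v ≤ x, V.IsAddress s v := by
  induction t using List.reverseRecOn generalizing x with
  | nil => exact ⟨x, le_rfl, by simpa using h⟩
  | append_singleton t c ih =>
    rw [← List.append_assoc] at h
    obtain ⟨w, hw, hm, rfl⟩ := h.of_snoc
    obtain ⟨v, hvw, hv⟩ := ih hw
    exact ⟨v, hvw.trans (covBy_next hm c).le, hv⟩

theorem nodeRank_add_length_le {s : List ℕ} {v : V.Node} (h : V.IsAddress s v) :
    V.nodeRank v + s.length ≤ V.rank := by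
  induction h with
  | nil => simp [Cascade.rank]
  | @snoc s v h hv c ih =>
    have hlt : V.nodeRank (V.next v c) < V.nodeRank v :=
      IsWellFounded.rank_lt_of_rel (r := fun w v => w ∈ V.succs v) (covBy_next hv c)
    calc V.nodeRank (V.next v c) + ((s ++ [c]).length : Ordinal)
        = (V.nodeRank (V.next v c) + 1) + s.length := by
          rw [List.length_append, List.length_singleton, add_comm s.length 1, Nat.cast_add,
            Nat.cast_one, add_assoc]
      _ ≤ V.nodeRank v + s.length := by gcongr; exact Order.add_one_le_of_lt hlt
      _ ≤ _ := ih

end IsAddress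

theorem exists_isAddress (x : V.Node) : ∃ s, V.IsAddress s x := by
  simpa using IsAddress.nil.exists_extension (bot_le : ⊥ ≤ x)

/-- The address of a maximal node. -/
noncomputable def leafAddress (V : MonotoneSequentialCascade) (x : V.MaxNode) : List ℕ :=
  (exists_isAddress x.1).choose

theorem isAddress_leafAddress (x : V.MaxNode) : V.IsAddress (V.leafAddress x) x.1 :=
  (exists_isAddress x.1).choose_spec

/-- Among maximal nodes the alternative `y < x` in the definition of `LexLT` does not occur. -/
theorem lexLT_iff (x y : V.MaxNode) : V.LexLT x y ↔ ∃ s c c', c < c' ∧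
    s ++ [c] <+: V.leafAddress x ∧ s ++ [c'] <+: V.leafAddress y := by
  constructor
  · rintro (h | ⟨v, hv, n, m, hx, hy, hnm⟩)
    · exact absurd x.2 (fun h' => y.2.not_lt h)
    · obtain ⟨s, hs⟩ := exists_isAddress v
      exact ⟨s, n, m, hnm, (hs.snoc hv n).isPrefix (isAddress_leafAddress x) hx,
        (hs.snoc hv m).isPrefix (isAddress_leafAddress y) hy⟩
  · rintro ⟨s, c, c', hc, ⟨t, ht⟩, ⟨t', ht'⟩⟩
    obtain ⟨w, hwx, hw⟩ := IsAddress.exists_le (ht ▸ isAddress_leafAddress x)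
    obtain ⟨w', hwy, hw'⟩ := IsAddress.exists_le (ht' ▸ isAddress_leafAddress y)
    obtain ⟨v, hv, hm, rfl⟩ := hw.of_snoc
    obtain ⟨v', hv', hm', rfl⟩ := hw'.of_snoc
    obtain rfl := hv.unique_node hv'
    exact Or.inr ⟨v, hm, c, c', hwx, hwy, hc⟩

theorem exists_diverge {x y : V.MaxNode} (h : x ≠ y) :
    ∃ s c c', c ≠ c' ∧ s ++ [c] <+: V.leafAddress x ∧ s ++ [c'] <+: V.leafAddress y := by
  have key : ∀ x y : V.MaxNode, V.leafAddress x <+: V.leafAddress y → x = y := by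
    rintro x y ⟨t, ht⟩
    obtain ⟨v, hv, hvx⟩ := IsAddress.exists_le (ht ▸ isAddress_leafAddress y)
    obtain rfl := hvx.unique_node (isAddress_leafAddress x)
    exact Subtype.ext (x.2.eq_of_le hv)
  exact List.exists_diverge (fun h' => h (key _ _ h')) fun h' => h (key _ _ h').symm

theorem lexLT_or_lexLT {x y : V.MaxNode} (h : x ≠ y) : V.LexLT x y ∨ V.LexLT y x := by
  obtain ⟨s, c, c', hc, hx, hy⟩ := exists_diverge h
  rcases hc.lt_or_gt with hc | hc
  · exact Or.inl ((lexLT_iff x y).2 ⟨s, c, c', hc, hx, hy⟩)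
  · exact Or.inr ((lexLT_iff y x).2 ⟨s, c', c, hc, hy, hx⟩)

/-- The lexicographic order being total on the maximal nodes, it is enough to check one
implication. -/
theorem isLexRespecting_of_lt {f : V.MaxNode → OmegaOne}
    (hf : ∀ x y : V.MaxNode, V.LexLT x y → f x < f y) : V.IsLexRespecting f := by
  refine fun x y => ⟨hf x y, fun hxy => ?_⟩
  refine (lexLT_or_lexLT ?_).resolve_right fun h => (hf y x h).asymm hxy
  rintro rfl
  exact hxy.false

/-- The `i`-th digit of a number in `max V`: the entry in place `i` of the address of the leaf that
it labels, and `0` if that address is too short. Outside `max V` the value is `0`. -/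
noncomputable def digit (V : MonotoneSequentialCascade) (i k : ℕ) : ℕ :=
  open Classical in
  if h : ∃ x, V.leaf x = k then (V.leafAddress h.choose).getD i 0 else 0

theorem digit_leaf (i : ℕ) (x : V.MaxNode) :
    V.digit i (V.leaf x) = (V.leafAddress x).getD i 0 := by
  have h : ∃ y, V.leaf y = V.leaf x := ⟨x, rfl⟩
  rw [digit, dif_pos h, V.leaf.injective h.choose_spec]

/-- The first `n` digits. -/
noncomputable def digits (V : MonotoneSequentialCascade) (n : ℕ) : List (ℕ → ℕ) :=
  (List.range n).map V.digit

@[simp] theorem length_digits (n : ℕ) : (V.digits n).length = n := by simp [digits]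

theorem isPrefix_listKey_digits {n : ℕ} {x : V.MaxNode} {s : List ℕ}
    (hs : s <+: V.leafAddress x) (hn : s.length ≤ n) :
    s <+: listKey (V.digits n) (V.leaf x) := by
  rw [List.prefix_iff_eq_take]
  refine List.ext_getElem (by simpa) fun i h₁ h₂ => ?_
  simp only [listKey, digits, List.map_map, List.getElem_take, List.getElem_map,
    List.getElem_range, Function.comp_apply, digit_leaf]
  rw [List.getD_eq_getElem _ _ (h₁.trans_le hs.length_le)]
  exact hs.getElem h₁

theorem length_leafAddress_le {n : ℕ} (hn : V.rank = n) (x : V.MaxNode) :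
    (V.leafAddress x).length ≤ n := by
  have := le_trans le_add_self (isAddress_leafAddress x).nodeRank_add_length_le
  rw [hn] at this
  exact_mod_cast this

theorem listKey_digits_lt {n : ℕ} (hn : V.rank = n) {x y : V.MaxNode} (h : V.LexLT x y) :
    listKey (V.digits n) (V.leaf x) < listKey (V.digits n) (V.leaf y) := by
  obtain ⟨s, c, c', hc, hx, hy⟩ := (lexLT_iff x y).1 h
  exact List.lt_of_isPrefix_of_lt
    (isPrefix_listKey_digits hx (hx.length_le.trans (length_leafAddress_le hn x)))
    (isPrefix_listKey_digits hy (hy.length_le.trans (length_leafAddress_le hn y))) hc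

theorem injOn_listKey_digits {n : ℕ} (hn : V.rank = n) :
    V.maxSet.InjOn (listKey (V.digits n)) := by
  rintro _ ⟨x, rfl⟩ _ ⟨y, rfl⟩ hxy
  by_contra h
  rcases lexLT_or_lexLT fun h' : x = y => h (h' ▸ rfl) with h | h
  · exact (listKey_digits_lt hn h).ne hxy
  · exact (listKey_digits_lt hn h).ne hxy.symm

theorem isLexRespecting_keyMap {n : ℕ} (hn : V.rank = n) :
    V.IsLexRespecting fun x => keyMap (V.digits n) (V.leaf x) :=
  isLexRespecting_of_lt fun _ _ h => keyMap_lt_iff.2 (listKey_digits_lt hn h)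

/-- By monotonicity, almost all immediate successors of a node of rank `k + 1` have rank exactly
`k`. -/
theorem exists_forall_nodeRank_next_eq {v : V.Node} {k : ℕ}
    (hv : V.nodeRank v = (k + 1 : ℕ)) :
    ¬ IsMax v ∧ ∃ m, ∀ c, m ≤ c → V.nodeRank (V.next v c) = k := by
  have hlt : ∀ w ∈ V.succs v, V.nodeRank w < (k + 1 : ℕ) := fun w hw =>
    (IsWellFounded.rank_lt_of_rel (r := fun w v => w ∈ V.succs v) hw).trans_eq hv
  obtain ⟨w, hw, hkw⟩ : ∃ w ∈ V.succs v, (k : Ordinal) ≤ V.nodeRank w := by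
    by_contra! hcon
    have hle : V.nodeRank v ≤ k := by
      rw [Cascade.nodeRank, IsWellFounded.rank_eq]
      refine Ordinal.iSup_le fun w => ?_
      exact Order.add_one_le_of_lt (hcon w.1 w.2)
    rw [hv] at hle
    exact absurd (Nat.cast_le.1 hle) (by omega)
  have hm : ¬ IsMax v := fun h => h.not_lt hw.lt
  obtain ⟨m, -, rfl⟩ := (V.bijOn_next v hm).surjOn hw
  refine ⟨hm, m, fun c hc => le_antisymm ?_ (hkw.trans (V.monotone_rank v hm hc))⟩
  have := hlt _ (covBy_next hm c)
  rwa [Nat.cast_succ, Order.lt_add_one_iff] at this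

/-- Almost all leaves in the sense of the contour have a digit in place `d` that exceeds a bound
depending on the digits before it. -/
theorem eventually_contour_digit {n : ℕ} (hn : V.rank = n) {d : ℕ} (hd : d < n)
    (M : List ℕ → ℕ) :
    ∀ᶠ x in V.contour, M (listKey (V.digits d) x) < V.digit d x := by
  -- `O` consists of the nodes up to level `d` that have the maximal rank possible on their level,
  -- and of all nodes above level `d` whose address exceeds the bound in place `d`. The former are
  -- not leaves.
  let O : Set V.Node :=
    {w | ∃ s, V.IsAddress s w ∧ s.length ≤ d ∧ V.nodeRank w = (n - s.length : ℕ)} ∪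
      {w | ∃ s c t, V.IsAddress (s ++ c :: t) w ∧ s.length = d ∧ M s < c}
  have hO : @IsOpen _ V.topology O := by
    rintro w (⟨s, hs, hsd, hw⟩ | ⟨s, c, t, hs, hsd, hc⟩) hm
    · obtain ⟨-, m, hmc⟩ := exists_forall_nodeRank_next_eq (k := n - s.length - 1)
        (hw.trans (by congr; omega))
      refine ((Set.finite_Iio (m + M s + 1)).image (V.next w)).subset ?_
      rintro w' ⟨hw', hw'O⟩
      obtain ⟨c, -, rfl⟩ := (V.bijOn_next w hm).surjOn hw'
      refine ⟨c, ?_, rfl⟩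
      by_contra! hcm
      simp only [Set.mem_Iio, not_lt] at hcm
      refine hw'O ?_
      rcases hsd.eq_or_lt with hsd | hsd
      · exact Or.inr ⟨s, c, [], hs.snoc hm c, hsd, by omega⟩
      · refine Or.inl ⟨s ++ [c], hs.snoc hm c, by simpa using hsd, ?_⟩
        rw [hmc c (by omega)]
        simp [Nat.sub_sub]
    · convert Set.finite_empty
      refine Set.sdiff_eq_empty.2 fun w' hw' => ?_
      obtain ⟨c', -, rfl⟩ := (V.bijOn_next w hm).surjOn hw'
      exact Or.inr ⟨s, c, t ++ [c'], by simpa using hs.snoc hm c', hsd, hc⟩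
  have hbot : (⊥ : V.Node) ∈ O := Or.inl ⟨[], .nil, by simp, by simpa [Cascade.rank] using hn⟩
  refine Filter.mem_map.2 (Filter.mem_comap.2 ⟨O, @IsOpen.mem_nhds _ V.topology _ _ hO hbot, ?_⟩)
  rintro x (⟨s, -, hsd, hw⟩ | ⟨s, c, t, hs, hsd, hc⟩)
  · obtain ⟨hm, -⟩ := exists_forall_nodeRank_next_eq (v := x.1) (k := n - s.length - 1)
      (hw.trans (by congr; omega))
    exact absurd x.2 hm
  · have hx := (isAddress_leafAddress x).unique hs
    have hs' : s = listKey (V.digits d) (V.leaf x) :=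
      (isPrefix_listKey_digits (hx ▸ List.prefix_append _ _) hsd.le).eq_of_length (by simp [hsd])
    change M (listKey (V.digits d) (V.leaf x)) < V.digit d (V.leaf x)
    rw [← hs', digit_leaf, hx, ← hsd]
    simpa using hc

theorem maxSet_mem_contour : V.maxSet ∈ V.contour := by
  refine Filter.mem_map.2 (Filter.univ_mem' fun x => Set.mem_range_self x)

theorem skyLT_digit {u : Ultrafilter ℕ} (hu : (u : Filter ℕ) ≤ V.contour) {n : ℕ}
    (hn : V.rank = n) {i d : ℕ} (hi : i < d) (hd : d < n) :
    SkyLT u (V.digit i) (V.digit d) := by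
  intro φ
  filter_upwards [hu (eventually_contour_digit hn hd fun s => φ (s.getD i 0))] with x hx
  have : (listKey (V.digits d) x).getD i 0 = V.digit i x := by
    rw [List.getD_eq_getElem _ _ (by simpa)]
    simp [listKey, digits]
  rwa [this] at hx

theorem skyLT_zero_digit {u : Ultrafilter ℕ} (hu : (u : Filter ℕ) ≤ V.contour) {n : ℕ}
    (hn : V.rank = n) {d : ℕ} (hd : d < n) : SkyLT u (fun _ => 0) (V.digit d) :=
  fun φ => hu (eventually_contour_digit hn hd fun _ => φ 0)

theorem pairwise_skyLT_digits {u : Ultrafilter ℕ} (hu : (u : Filter ℕ) ≤ V.contour) {n : ℕ}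
    (hn : V.rank = n) : (V.digits n).Pairwise (SkyLT u) := by
  rw [List.pairwise_iff_getElem]
  intro i j hi hj hij
  simpa [digits] using skyLT_digit hu hn hij (by simpa using hj)

end MonotoneSequentialCascade

/-! ### Cascades from trees of sequences -/

/-- A tree of finite sequences of natural numbers in which all maximal elements have the length
`height` and each other element has infinitely many one-element extensions. -/
structure UniformTree where
  height : ℕ
  carrier : Set (List ℕ)
  nil_mem : [] ∈ carrier
  mem_of_snoc_mem : ∀ {s : List ℕ} {c : ℕ}, s ++ [c] ∈ carrier → s ∈ carrier
  length_le : ∀ {s : List ℕ}, s ∈ carrier → s.length ≤ height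
  infinite : ∀ {s : List ℕ}, s ∈ carrier → s.length < height → {c | s ++ [c] ∈ carrier}.Infinite

namespace UniformTree

/-- A node of the tree. A separate structure, rather than a subtype of `List ℕ`, keeps the order by
initial segments apart from the lexicographic order of `List ℕ`. -/
@[ext]
structure Node (S : UniformTree) where
  val : List ℕ
  mem : val ∈ S.carrier

variable {S : UniformTree}

theorem mem_of_isPrefix {s t : List ℕ} (h : s <+: t) (ht : t ∈ S.carrier) : s ∈ S.carrier := by
  obtain ⟨r, rfl⟩ := h
  induction r using List.reverseRecOn with
  | nil => simpa using ht
  | append_singleton r c ih =>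
    rw [← List.append_assoc] at ht
    exact ih (S.mem_of_snoc_mem ht)

instance : PartialOrder S.Node where
  le v w := v.val <+: w.val
  le_refl v := List.prefix_refl v.val
  le_trans _ _ _ h h' := h.trans h'
  le_antisymm v w h h' := Node.ext (h.eq_of_length_le h'.length_le)

instance : OrderBot S.Node where
  bot := ⟨[], S.nil_mem⟩
  bot_le _ := List.nil_prefix

theorem Node.covBy_iff {v w : S.Node} : v ⋖ w ↔ ∃ c, w.val = v.val ++ [c] := by
  constructor
  · intro h
    obtain ⟨r, hr⟩ := h.le
    rcases r with _ | ⟨c, r⟩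
    · exact absurd (Node.ext (by simpa using hr)) h.ne
    · have hc : v.val ++ [c] <+: w.val := ⟨r, by simpa using hr⟩
      refine ⟨c, ?_⟩
      have hv : v ≤ (⟨v.val ++ [c], mem_of_isPrefix hc w.mem⟩ : S.Node) := ⟨[c], rfl⟩
      rcases h.eq_or_eq hv hc with h' | h'
      · have := congrArg Node.val h'
        simp at this
      · exact (congrArg Node.val h').symm
  · rintro ⟨c, hc⟩
    have hlt : v < w := by
      refine lt_of_le_of_ne ⟨[c], hc.symm⟩ fun h => ?_
      rw [h] at hc
      simp at hc
    refine ⟨hlt, fun z hvz hzw => ?_⟩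
    have h₁ : v.val.length < z.val.length := by
      by_contra! hle
      exact hvz.ne (Node.ext (hvz.le.eq_of_length_le hle))
    have h₂ : z.val.length < w.val.length := by
      by_contra! hle
      exact hzw.ne (Node.ext (hzw.le.eq_of_length_le hle))
    simp only [hc, List.length_append, List.length_singleton] at h₂
    omega

theorem Node.isMax_iff {v : S.Node} : IsMax v ↔ v.val.length = S.height := by
  constructor
  · intro h
    by_contra hne
    obtain ⟨c, hc⟩ := (S.infinite v.mem (lt_of_le_of_ne (S.length_le v.mem) hne)).nonempty
    exact h.not_lt (Node.covBy_iff.2 ⟨c, rfl⟩ : v ⋖ ⟨_, hc⟩).lt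
  · intro h w hw
    have hw' : v.val <+: w.val := hw
    exact (Node.ext (hw'.eq_of_length_le ((S.length_le w.mem).trans h.ge)) : v = w).ge

/-- The tree as a cascade. -/
@[reducible]
def toCascade (S : UniformTree) : Cascade where
  Node := S.Node
  isChain_Iic v a ha b hb _ := List.prefix_or_prefix_of_prefix ha hb
  finite_of_branch b hb := by
    refine Set.Finite.of_finite_image (f := fun v => v.val.length)
      ((Set.finite_Iic S.height).subset ?_) ?_
    · rintro _ ⟨v, -, rfl⟩
      exact S.length_le v.mem
    · intro v hv w hw h
      rcases hb.1.total hv hw with hle | hle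
      · exact Node.ext (hle.eq_of_length h)
      · exact (Node.ext (hle.eq_of_length h.symm)).symm

theorem nodeRank_toCascade (v : S.Node) :
    S.toCascade.nodeRank v = (S.height - v.val.length : ℕ) := by
  induction hk : S.height - v.val.length generalizing v with
  | zero =>
    rw [Cascade.nodeRank, IsWellFounded.rank_eq]
    have hmax : IsMax v := Node.isMax_iff.2 (by have := S.length_le v.mem; omega)
    have : IsEmpty {w : S.Node // w ∈ S.toCascade.succs v} :=
      ⟨fun w => hmax.not_lt (CovBy.lt w.2)⟩
    simp
  | succ k ih =>
    rw [Cascade.nodeRank, IsWellFounded.rank_eq]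
    obtain ⟨c, hc⟩ := (S.infinite v.mem (by omega)).nonempty
    have : Nonempty {w : S.Node // w ∈ S.toCascade.succs v} :=
      ⟨⟨⟨_, hc⟩, Node.covBy_iff.2 ⟨c, rfl⟩⟩⟩
    have hw : ∀ w : {w : S.Node // w ∈ S.toCascade.succs v},
        S.toCascade.nodeRank w.1 = (k : Ordinal.{0}) := by
      rintro ⟨w, hw⟩
      obtain ⟨c, hc⟩ := Node.covBy_iff.1 hw
      exact ih w (by simp [hc]; omega)
    simp only [Cascade.nodeRank] at hw
    simp [hw]

open Classical in
/-- The tree as a monotone sequential cascade, whose maximal nodes are identified with natural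
numbers by `label`. The immediate successors of a node are enumerated in the order of their last
entries. -/
noncomputable def toMonotone (S : UniformTree) (label : List ℕ → ℕ)
    (hlabel : {s ∈ S.carrier | s.length = S.height}.InjOn label) :
    MonotoneSequentialCascade where
  toCascade := S.toCascade
  next v n := if h : v.val.length < S.height then
    ⟨v.val ++ [Nat.nth (fun c => v.val ++ [c] ∈ S.carrier) n],
      Nat.nth_mem_of_infinite (S.infinite v.mem h) n⟩ else v
  bijOn_next v hv := by
    have hlt : v.val.length < S.height :=
      lt_of_le_of_ne (S.length_le v.mem) fun h => hv (Node.isMax_iff.2 h)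
    simp only [hlt, dif_pos]
    refine ⟨fun n _ => Node.covBy_iff.2 ⟨_, rfl⟩, fun n _ m _ h => ?_, fun w hw => ?_⟩
    · have := congrArg Node.val h
      simp only [List.append_cancel_left_eq, List.cons.injEq, and_true] at this
      exact Nat.nth_injective (S.infinite v.mem hlt) this
    · obtain ⟨c, hc⟩ := Node.covBy_iff.1 hw
      have hmem : c ∈ Set.range (Nat.nth fun c => v.val ++ [c] ∈ S.carrier) := by
        rw [Nat.range_nth_of_infinite (S.infinite v.mem hlt)]
        exact (hc ▸ w.mem : v.val ++ [c] ∈ S.carrier)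
      obtain ⟨n, rfl⟩ := hmem
      exact ⟨n, Set.mem_univ n, Node.ext hc.symm⟩
  monotone_rank v hv := by
    have hlt : v.val.length < S.height :=
      lt_of_le_of_ne (S.length_le v.mem) fun h => hv (Node.isMax_iff.2 h)
    intro n m _
    simp [hlt, nodeRank_toCascade]
  leaf := ⟨fun v => label v.1.val, fun v w h => Subtype.ext <| Node.ext <|
    hlabel ⟨v.1.mem, Node.isMax_iff.1 v.2⟩ ⟨w.1.mem, Node.isMax_iff.1 w.2⟩ h⟩

section

variable {label : List ℕ → ℕ} {hlabel : {s ∈ S.carrier | s.length = S.height}.InjOn label}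

theorem rank_toMonotone : (S.toMonotone label hlabel).rank = (S.height : Ordinal.{0}) :=
  nodeRank_toCascade _

theorem val_lt_of_lexLT {x y : (S.toMonotone label hlabel).MaxNode}
    (h : (S.toMonotone label hlabel).LexLT x y) : x.1.val < y.1.val := by
  rcases h with h | ⟨v, hv, n, m, hx, hy, hnm⟩
  · exact absurd h y.2.not_lt
  · have hlt : v.val.length < S.height :=
      lt_of_le_of_ne (S.length_le v.mem) fun h => hv (Node.isMax_iff.2 h)
    have hnext : ∀ n, ((S.toMonotone label hlabel).next v n).val =
        v.val ++ [Nat.nth (fun c => v.val ++ [c] ∈ S.carrier) n] :=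
      fun n => congrArg Node.val (dif_pos hlt)
    have hx' : ((S.toMonotone label hlabel).next v n).val <+: x.1.val := hx
    have hy' : ((S.toMonotone label hlabel).next v m).val <+: y.1.val := hy
    rw [hnext] at hx' hy'
    exact List.lt_of_isPrefix_of_lt hx' hy' (Nat.nth_strictMono (S.infinite v.mem hlt) hnm)

/-- An ultrafilter `u` contains the contour of a tree whose maximal nodes are lists of values of
functions in increasing skies: level by level, `u`-almost all of these lists stay in a given open
neighbourhood of the least element, which omits only finitely many immediate successors of each of
its nodes. -/
theorem le_contour {u : Ultrafilter ℕ} {l : List (ℕ → ℕ)} (hl : l.Pairwise (SkyLT u))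
    (hl₀ : ∀ g ∈ l, SkyLT u (fun _ => 0) g) (hlen : l.length = S.height)
    (hmem : ∀ᶠ x in (u : Filter ℕ), listKey l x ∈ S.carrier)
    (hlab : ∀ᶠ x in (u : Filter ℕ), label (listKey l x) = x) :
    (u : Filter ℕ) ≤ (S.toMonotone label hlabel).contour := by
  intro B hB
  obtain ⟨P, hP, hPB⟩ := Filter.mem_comap.1 (Filter.mem_map.1 hB)
  obtain ⟨O, hOP, hO, hbot⟩ := (@mem_nhds_iff _ S.toCascade.topology _ _).1 hP
  -- `M s` bounds the last entries of the immediate successors of `s` that the open set `O` omits.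
  have hM : ∀ s : List ℕ, ∃ m, ∀ hs : s ∈ S.carrier, (⟨s, hs⟩ : S.Node) ∈ O →
      s.length < S.height → ∀ c, m < c → ∀ hc : s ++ [c] ∈ S.carrier,
        (⟨s ++ [c], hc⟩ : S.Node) ∈ O := by
    intro s
    by_cases h : ∃ hs : s ∈ S.carrier, (⟨s, hs⟩ : S.Node) ∈ O ∧ s.length < S.height
    · obtain ⟨hs, hsO, hlt⟩ := h
      have hfin := hO ⟨s, hs⟩ hsO fun hmax => hlt.ne (Node.isMax_iff.1 hmax)
      obtain ⟨m, hm⟩ := (hfin.image fun w : S.Node => w.val.getLastD 0).bddAbove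
      refine ⟨m, fun _ _ _ c hmc hc => ?_⟩
      by_contra hcO
      have := hm ⟨⟨s ++ [c], hc⟩, ⟨Node.covBy_iff.2 ⟨c, rfl⟩, hcO⟩, rfl⟩
      simp at this
      omega
    · exact ⟨0, fun hs hsO hlt => absurd ⟨hs, hsO, hlt⟩ h⟩
  choose M hM using hM
  have key : ∀ d ≤ l.length, ∀ᶠ x in (u : Filter ℕ),
      ∃ h : (listKey l x).take d ∈ S.carrier, (⟨_, h⟩ : S.Node) ∈ O := by
    intro d hd
    induction d with
    | zero => exact .of_forall fun x => ⟨S.nil_mem, hbot⟩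
    | succ d ih =>
      filter_upwards [ih (by omega), hmem, eventually_take_listKey_lt hl hl₀ hd M] with x hx hxS hxM
      obtain ⟨hs, hsO⟩ := hx
      have htake := take_succ_listKey hd x
      have hc : (listKey l x).take d ++ [l[d] x] ∈ S.carrier :=
        htake ▸ mem_of_isPrefix (List.take_prefix _ _) hxS
      have hO' := hM _ hs hsO (by simp; omega) _ hxM hc
      simp only [htake]
      exact ⟨hc, hO'⟩
  filter_upwards [key l.length le_rfl, hlab] with x hx hxl
  rw [List.take_of_length_le (by simp)] at hx
  obtain ⟨hs, hsO⟩ := hx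
  have hmax : IsMax (⟨listKey l x, hs⟩ : S.Node) := Node.isMax_iff.2 (by simpa using hlen)
  have := hPB (show (⟨⟨listKey l x, hs⟩, hmax⟩ : S.toCascade.MaxNode) ∈ _ from hOP hsO)
  exact hxl ▸ this

end

end UniformTree

/-- `ManyBranches l A k s` says that `s` can be extended, with infinitely many choices for each of
`k` further entries in turn, to lists of values of the functions in `l` at points of `A`. -/
def ManyBranches (l : List (ℕ → ℕ)) (A : Set ℕ) : ℕ → List ℕ → Prop
  | 0, s => ∃ x ∈ A, listKey l x = s
  | k + 1, s => {c | ManyBranches l A k (s ++ [c])}.Infinite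

theorem eventually_manyBranches {u : Ultrafilter ℕ} {l : List (ℕ → ℕ)}
    (hl : l.Pairwise (SkyLT u)) (hl₀ : ∀ g ∈ l, SkyLT u (fun _ => 0) g) {A : Set ℕ}
    (hA : A ∈ (u : Filter ℕ)) {k : ℕ} (hk : k ≤ l.length) :
    ∀ᶠ x in (u : Filter ℕ), ManyBranches l A k ((listKey l x).take (l.length - k)) := by
  induction k with
  | zero =>
    filter_upwards [hA] with x hx
    exact ⟨x, hx, by rw [List.take_of_length_le (by simp)]⟩
  | succ k ih =>
    obtain ⟨d, hd⟩ : ∃ d, d = l.length - (k + 1) := ⟨_, rfl⟩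
    have hdl : d < l.length := by omega
    -- A list with finitely many good extensions has a bound for their last entries, which `l[d]`
    -- exceeds.
    have hM : ∀ s : List ℕ, ∃ m, {c | ManyBranches l A k (s ++ [c])}.Finite →
        ∀ c, ManyBranches l A k (s ++ [c]) → c ≤ m := by
      intro s
      by_cases h : {c | ManyBranches l A k (s ++ [c])}.Finite
      · obtain ⟨m, hm⟩ := h.bddAbove
        exact ⟨m, fun _ c hc => hm hc⟩
      · exact ⟨0, fun h' => absurd h' h⟩
    choose M hM using hM
    filter_upwards [ih (by omega), eventually_take_listKey_lt hl hl₀ hdl M] with x hx hxM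
    rw [← hd]
    intro hfin
    rw [show l.length - k = d + 1 by omega, take_succ_listKey hdl] at hx
    exact hxM.not_ge (hM _ hfin _ hx)

/-- The lists all of whose initial segments `t` satisfy `ManyBranches l A (l.length - t.length) t`.
-/
def prunedTree (l : List (ℕ → ℕ)) (A : Set ℕ) (h : ManyBranches l A l.length []) :
    UniformTree where
  height := l.length
  carrier := {s | s.length ≤ l.length ∧ ∀ t, t <+: s → ManyBranches l A (l.length - t.length) t}
  nil_mem := ⟨by simp, fun t ht => by simpa [List.prefix_nil.1 ht] using h⟩
  mem_of_snoc_mem h :=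
    ⟨(List.prefix_append _ _).length_le.trans h.1, fun t ht =>
      h.2 t (ht.trans (List.prefix_append _ _))⟩
  length_le h := h.1
  infinite {s} h hlt := by
    have hs := h.2 s (List.prefix_refl s)
    obtain ⟨k, hk⟩ : ∃ k, l.length - s.length = k + 1 := ⟨l.length - s.length - 1, by omega⟩
    rw [hk] at hs
    refine Set.Infinite.mono (fun c hc => ⟨by simpa using hlt, fun t ht => ?_⟩) hs
    rcases List.prefix_concat_iff.1 ht with rfl | ht
    · rw [List.length_append, List.length_singleton, show l.length - (s.length + 1) = k by omega]
      exact hc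
    · exact h.2 t ht

/-! ### Merging two cascades -/

/-- Functions in increasing skies that together separate the points of a set in `u` are the levels
of a cascade whose contour is contained in `u`. -/
theorem exists_cascade_of_pairwise_skyLT {u : Ultrafilter ℕ} {l : List (ℕ → ℕ)}
    (hl : l.Pairwise (SkyLT u)) (hl₀ : ∀ g ∈ l, SkyLT u (fun _ => 0) g) {A : Set ℕ}
    (hA : A ∈ (u : Filter ℕ)) (hinj : A.InjOn (listKey l)) :
    ∃ T : MonotoneSequentialCascade, T.rank = (l.length : Ordinal.{0}) ∧
      (u : Filter ℕ) ≤ T.contour ∧ T.maxSet ⊆ A ∧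
      T.IsLexRespecting fun x => MonotoneSequentialCascade.keyMap l (T.leaf x) := by
  classical
  have hroot : ManyBranches l A l.length [] := by
    simpa using (eventually_manyBranches hl hl₀ hA le_rfl).exists
  let S := prunedTree l A hroot
  let label : List ℕ → ℕ := fun s => if h : ∃ x ∈ A, listKey l x = s then h.choose else 0
  have hlab : ∀ x ∈ A, label (listKey l x) = x := by
    intro x hx
    have h : ∃ y ∈ A, listKey l y = listKey l x := ⟨x, hx, rfl⟩
    simp only [label, dif_pos h]
    exact hinj h.choose_spec.1 hx h.choose_spec.2
  have hS : ∀ s ∈ S.carrier, s.length = S.height → ∃ x ∈ A, listKey l x = s := by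
    intro s hs hlen
    have := hs.2 s (List.prefix_refl s)
    rwa [hlen, show l.length - S.height = 0 from Nat.sub_self _] at this
  have hlabel : {s ∈ S.carrier | s.length = S.height}.InjOn label := by
    rintro s ⟨hs, hsl⟩ t ⟨ht, htl⟩ hst
    obtain ⟨x, hx, rfl⟩ := hS s hs hsl
    obtain ⟨y, hy, rfl⟩ := hS t ht htl
    rw [hlab x hx, hlab y hy] at hst
    rw [hst]
  have hmem : ∀ᶠ x in (u : Filter ℕ), listKey l x ∈ S.carrier := by
    have hall : ∀ᶠ x in (u : Filter ℕ), ∀ k ∈ Finset.range (l.length + 1),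
        ManyBranches l A k ((listKey l x).take (l.length - k)) :=
      (Filter.eventually_all_finset _).2 fun k hk =>
        eventually_manyBranches hl hl₀ hA (Nat.lt_succ_iff.1 (Finset.mem_range.1 hk))
    filter_upwards [hall] with x hx
    refine ⟨by simp, fun t ht => ?_⟩
    have htl : t.length ≤ l.length := by simpa using ht.length_le
    have := hx (l.length - t.length) (by simp)
    rwa [Nat.sub_sub_self htl, ← List.prefix_iff_eq_take.1 ht] at this
  refine ⟨S.toMonotone label hlabel, UniformTree.rank_toMonotone,
    UniformTree.le_contour hl hl₀ rfl hmem (by filter_upwards [hA] with x hx using hlab x hx),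
    ?_, ?_⟩
  · rintro _ ⟨v, rfl⟩
    obtain ⟨x, hx, hxv⟩ := hS v.1.val v.1.mem (UniformTree.Node.isMax_iff.1 v.2)
    change label v.1.val ∈ A
    rwa [← hxv, hlab x hx]
  · have hkey : ∀ v : (S.toMonotone label hlabel).MaxNode,
        listKey l ((S.toMonotone label hlabel).leaf v) = v.1.val := by
      intro v
      obtain ⟨x, hx, hxv⟩ := hS v.1.val v.1.mem (UniformTree.Node.isMax_iff.1 v.2)
      change listKey l (label v.1.val) = _
      rw [← hxv, hlab x hx]
    refine MonotoneSequentialCascade.isLexRespecting_of_lt fun x y h => ?_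
    rw [MonotoneSequentialCascade.keyMap_lt_iff, hkey, hkey]
    exact UniformTree.val_lt_of_lexLT h

theorem corollary3p6 (u : Ultrafilter ℕ) (V W : MonotoneSequentialCascade)
    (hV : V.rank < ω) (hW : W.rank < ω)
    (huV : V.contour.sets ⊆ (u : Filter ℕ).sets) (huW : W.contour.sets ⊆ (u : Filter ℕ).sets) :
    ∃ T : MonotoneSequentialCascade,
      T.rank < ω ∧ max V.rank W.rank ≤ T.rank ∧
        T.contour.sets ⊆ (u : Filter ℕ).sets ∧ T.IncreasesOrder V := by
  obtain ⟨n, hn⟩ := Ordinal.lt_omega0.1 hV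
  obtain ⟨m, hm⟩ := Ordinal.lt_omega0.1 hW
  replace huV : (u : Filter ℕ) ≤ V.contour := huV
  replace huW : (u : Filter ℕ) ≤ W.contour := huW
  obtain ⟨l, hsub, hml, hl, hmem⟩ := exists_merge (V.digits n) (W.digits m)
    (V.pairwise_skyLT_digits huV hn) (W.pairwise_skyLT_digits huW hm)
  have hl₀ : ∀ g ∈ l, SkyLT u (fun _ => 0) g := by
    intro g hg
    rcases hmem g hg with hg | hg
    · obtain ⟨d, hd, rfl⟩ := List.mem_map.1 hg
      exact V.skyLT_zero_digit huV hn (List.mem_range.1 hd)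
    · obtain ⟨d, hd, rfl⟩ := List.mem_map.1 hg
      exact W.skyLT_zero_digit huW hm (List.mem_range.1 hd)
  have hincr : ∀ᶠ x in (u : Filter ℕ), l.Pairwise fun g h => g x ≤ h x :=
    eventually_pairwise_le hl
  have hinj : (V.maxSet ∩ {x | l.Pairwise fun g h => g x ≤ h x}).InjOn (listKey l) := by
    rintro x ⟨hx, -⟩ y ⟨hy, -⟩ hxy
    refine V.injOn_listKey_digits hn hx hy ?_
    refine List.map_congr_left fun g hg => ?_
    exact List.map_inj_left.1 hxy g (hsub.subset hg)
  obtain ⟨T, hT, huT, hTA, hlex⟩ := exists_cascade_of_pairwise_skyLT hl hl₀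
    (Filter.inter_mem (huV V.maxSet_mem_contour) hincr) hinj
  have hTV : T.maxSet ⊆ V.maxSet := fun x hx => (hTA hx).1
  refine ⟨T, hT ▸ Ordinal.natCast_lt_omega0 _, ?_, huT, hTV, _, _, hlex,
    V.isLexRespecting_keyMap hn, fun U hU => ?_⟩
  · rw [hT, hn, hm, max_le_iff]
    exact ⟨by exact_mod_cast by simpa using hsub.length_le, by exact_mod_cast by simpa using hml⟩
  · have himage : ∀ (X : MonotoneSequentialCascade) (f : ℕ → OmegaOne), U ⊆ X.maxSet →
        (fun x => f (X.leaf x)) '' (X.leaf ⁻¹' U) = f '' U := by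
      intro X f hUX
      rw [← Set.image_image f X.leaf, Set.image_preimage_eq_of_subset hUX]
    rw [himage V _ (hU.trans hTV), himage T _ hU]
    refine MonotoneSequentialCascade.indec_ot_le
      (fun _ _ _ _ => MonotoneSequentialCascade.keyMap_lt_iff)
      ((V.injOn_listKey_digits hn).mono (hU.trans hTV))
      (fun _ _ _ _ => MonotoneSequentialCascade.keyMap_lt_iff) hsub ?_
    rw [List.pairwise_iff_getElem]
    exact fun i j hi hj hij x hx => List.pairwise_iff_getElem.1 (hTA (hU hx)).2 i j hi hj hij
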